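/- Let $(\overline M,\overline g)$ be a smooth Riemannian manifold of dimension $m+1\ge 3$, let $\Sigma$ be an (isometrically immersed) hypersurface of $\overline M$, let $q\in\Sigma$, and let $N(q)$ be a unit normal vector to $\Sigma$ at $q$. Fix an integer $s$ with $0<s\le m-1$ and an orthonormal basis $\{e_1,\dots,e_m\}$ of $T_q\Sigma$ consisting of eigenvectors of the Weingarten operator of $\Sigma$ at $q$ (with respect to $N(q)$). For each subset $\alpha\subset\{e_1,\dots,e_m\}$ with exactly $s$ elements, let $M_\alpha$ be an $(s+1)$-dimensional (isometrically immersed) submanifold of $\overline M$ through $q$ with $T_qM_\alpha=\operatorname{span}(\{N(q)\}\cup\alpha)$ which is totally geodesic at $q$, that is, every geodesic of $M_\alpha$ starting at $q$ is, near the initial time, a geodesic of $\overline M$. Let $S_{M_\alpha}=M_\alpha\cap\Sigma$ (near $q$), an $s$-dimensional hypersurface of $M_\alpha$ with unit normal $N(q)$ at $q$. Suppose that the mean curvature at $q$ of $S_{M_\alpha}$ as a hypersurface of $M_\alpha$, with respect to $N(q)$, is the same for all $\alpha$. Then $q$ is an umbilic point of $\Sigma$, that is, $\mathrm{II}_\Sigma(u,v)=\overline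 g(u,v)\,\mathrm H(q)$ for all $u,v\in T_q\Sigma$, where $\mathrm{II}_\Sigma$ is the second fundamental form and $\mathrm H(q)=\frac1m\operatorname{trace}\mathrm{II}_\Sigma(q)$ is the mean curvature vector; and the mean curvature of $\Sigma$ at $q$ with respect to $N(q)$ equals the mean curvature of $S_{M_\alpha}$ in $M_\alpha$ at $q$, for every $\alpha$. -/

import Mathlib

open scoped Manifold ContDiff Topology

noncomputable section

namespace Umbilic

/-- The model space `ℝⁿ`. Manifolds of dimension `n` are modelled on `ℝⁿ` through `𝓡 n`, so they
have no boundary. -/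
abbrev Model (n : ℕ) : Type := EuclideanSpace ℝ (Fin n)

/-- The `i`-th vector of the standard basis of `ℝⁿ`. -/
abbrev stdVec {n : ℕ} (i : Fin n) : Model n := EuclideanSpace.single i (1 : ℝ)

/-- A smooth Riemannian metric on the `n`-dimensional smooth manifold `M`; the inner product of
`u, v ∈ T_x M` is `g.inner x u v`. -/
abbrev SmoothMetric (n : ℕ) (M : Type*) [TopologicalSpace M] [ChartedSpace (Model n) M]
    [IsManifold (𝓡 n) ∞ M] : Type _ :=
  Bundle.ContMDiffRiemannianMetric (𝓡 n) ∞ (Model n) (fun x : M ↦ TangentSpace (𝓡 n) x)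

section LeviCivita

variable {n : ℕ} {M : Type*} [TopologicalSpace M] [ChartedSpace (Model n) M]
  [IsManifold (𝓡 n) ∞ M]

/-- The matrix `(g_ij (y))` of the metric in the chart centred at `p`, at the point `y` of the
target of the chart. -/
def gram (g : SmoothMetric n M) (p : M) (y : Model n) : Matrix (Fin n) (Fin n) ℝ :=
  Matrix.of fun i j ↦
    g.inner ((chartAt (Model n) p).symm y)
      (mfderiv (𝓡 n) (𝓡 n) (chartAt (Model n) p).symm y (stdVec i))
      (mfderiv (𝓡 n) (𝓡 n) (chartAt (Model n) p).symm y (stdVec j))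

/-- `∂_l g_ij` at the point `y` of the target of the chart centred at `p`. -/
def dGram (g : SmoothMetric n M) (p : M) (y : Model n) (l i j : Fin n) : ℝ :=
  fderiv ℝ (fun z : Model n ↦ gram g p z i j) y (stdVec l)

/-- The Christoffel symbols of the Levi-Civita connection in the chart centred at `p`:
`Γ^k_ij = (1/2) ∑_l g^{kl} (∂_i g_jl + ∂_j g_il - ∂_l g_ij)`. -/
def christoffel (g : SmoothMetric n M) (p : M) (y : Model n) (i j k : Fin n) : ℝ :=
  (1 / 2) * ∑ l, (gram g p y)⁻¹ k l * (dGram g p y i j l + dGram g p y j i l - dGram g p y l i j)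

/-- The vector `Γ(u, v)` with coordinates `∑_{ij} Γ^k_ij u^i v^j`. -/
def christoffelVec (g : SmoothMetric n M) (p : M) (y u v : Model n) : Model n :=
  WithLp.toLp 2 fun k ↦ ∑ i, ∑ j, christoffel g p y i j k * u i * v j

/-- The curve `c` is a geodesic in a neighbourhood of `t₀`: it is of class `C²` there and, in the chart
centred at `c t₀`, the geodesic equation `c'' + Γ(c', c') = 0` holds for all `t` near `t₀`. (The
equation then makes `c` smooth near `t₀`.) -/
def IsGeodesicAt (g : SmoothMetric n M) (c : ℝ → M) (t₀ : ℝ) : Prop :=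
  ContMDiffAt 𝓘(ℝ, ℝ) (𝓡 n) 2 c t₀ ∧
    ∀ᶠ t in 𝓝 t₀,
      deriv (deriv fun τ ↦ chartAt (Model n) (c t₀) (c τ)) t +
        christoffelVec g (c t₀) (chartAt (Model n) (c t₀) (c t))
          (deriv (fun τ ↦ chartAt (Model n) (c t₀) (c τ)) t)
          (deriv (fun τ ↦ chartAt (Model n) (c t₀) (c τ)) t) = 0

end LeviCivita

section Immersion

variable {k : ℕ} {P : Type*} [TopologicalSpace P] [ChartedSpace (Model k) P]
  [IsManifold (𝓡 k) ∞ P]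
  {n : ℕ} {M : Type*} [TopologicalSpace M] [ChartedSpace (Model n) M] [IsManifold (𝓡 n) ∞ M]

/-- `f : (P, gP) → (M, gM)` is an isometric immersion. -/
structure IsIsometricImmersion (gP : SmoothMetric k P) (gM : SmoothMetric n M) (f : P → M) :
    Prop where
  smooth : ContMDiff (𝓡 k) (𝓡 n) ∞ f
  isometric : ∀ (x : P) (u v : TangentSpace (𝓡 k) x),
    gM.inner (f x) (mfderiv (𝓡 k) (𝓡 n) f x u) (mfderiv (𝓡 k) (𝓡 n) f x v) = gP.inner x u v

/-- The immersion `f` is totally geodesic at `p`: it carries every geodesic of `P` that starts at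
`p` into a curve which is a geodesic of `M` near the initial time. -/
def TotallyGeodesicAt (gP : SmoothMetric k P) (gM : SmoothMetric n M) (f : P → M) (p : P) :
    Prop :=
  ∀ c : ℝ → P, c 0 = p → IsGeodesicAt gP c 0 → IsGeodesicAt gM (f ∘ c) 0

/-- The covariant derivative `∇_u V ∈ T_{f x} M`, for the Levi-Civita connection of `M`, of a vector
field `V` along the map `f : P → M` in the direction of `u ∈ T_x P`. In the chart of `M` centred at
`f x`, its coordinate expression is `dV(u) + Γ(df(u), V)`. -/
def covDeriv (gM : SmoothMetric n M) (f : P → M) (V : ∀ x : P, TangentSpace (𝓡 n) (f x)) (x : P)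
    (u : TangentSpace (𝓡 k) x) : TangentSpace (𝓡 n) (f x) :=
  let dφ : ∀ z : M, TangentSpace (𝓡 n) z → Model n :=
    fun z w ↦ mfderiv (𝓡 n) (𝓡 n) (chartAt (Model n) (f x)) z w
  let dV : Model n := mfderiv (𝓡 k) 𝓘(ℝ, Model n) (fun y : P ↦ dφ (f y) (V y)) x u
  (mfderiv (𝓡 n) (𝓡 n) (chartAt (Model n) (f x)) (f x)).inverse
    (dV + christoffelVec gM (f x) (chartAt (Model n) (f x) (f x))
      (dφ (f x) (mfderiv (𝓡 k) (𝓡 n) f x u)) (dφ (f x) (V x)) : Model n)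

/-- The `i`-th vector of the coordinate basis of `T_q P`. -/
abbrev coordVec (q : P) (i : Fin k) : TangentSpace (𝓡 k) q := (stdVec i : Model k)

/-- The matrix of the metric of `P` at `q` in the coordinate basis of `T_q P`. -/
def gramAt (gP : SmoothMetric k P) (q : P) : Matrix (Fin k) (Fin k) ℝ :=
  Matrix.of fun i j ↦ gP.inner q (coordVec q i) (coordVec q j)

/-- The component of `X ∈ T_{f q} M` normal to the isometric immersion `f`: one subtracts from `X`
its orthogonal projection `∑_{ij} g^{ij} ⟨X, df(∂_j)⟩ df(∂_i)` onto `df(T_q P)`. -/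
def normalPart (gP : SmoothMetric k P) (gM : SmoothMetric n M) (f : P → M) (q : P)
    (X : TangentSpace (𝓡 n) (f q)) : TangentSpace (𝓡 n) (f q) :=
  X - ∑ i, ∑ j, ((gramAt gP q)⁻¹ i j *
      gM.inner (f q) X (mfderiv (𝓡 k) (𝓡 n) f q (coordVec q j))) •
    mfderiv (𝓡 k) (𝓡 n) f q (coordVec q i)

/-- The second fundamental form `II(u, v)` of the isometric immersion `f` at `q`: by the Gauss
formula, it is the normal component of `∇_u (df(Y))`, where `∇` is the Levi-Civita connection of `M`
and `Y` is a local vector field on `P` with `Y(q) = v`. (The choice of `Y` does not matter; the one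
used here has constant coordinates near `q`.) -/
def secondFundamentalForm (gP : SmoothMetric k P) (gM : SmoothMetric n M) (f : P → M) (q : P)
    (u v : TangentSpace (𝓡 k) q) : TangentSpace (𝓡 n) (f q) :=
  normalPart gP gM f q
    (covDeriv gM f
      (fun x ↦ mfderiv (𝓡 k) (𝓡 n) f x
        (FiberBundle.extend (E := fun x : P ↦ TangentSpace (𝓡 k) x) (Model k) v x)) q u)

/-- The mean curvature vector `(1/k) trace II = (1/k) ∑_{ij} g^{ij} II(∂_i, ∂_j)` at `q`. -/
def meanCurvatureVector (gP : SmoothMetric k P) (gM : SmoothMetric n M) (f : P → M) (q : P) :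
    TangentSpace (𝓡 n) (f q) :=
  (1 / (k : ℝ)) • ∑ i, ∑ j, (gramAt gP q)⁻¹ i j •
    secondFundamentalForm gP gM f q (coordVec q i) (coordVec q j)

/-- The point `q` is umbilic: `II(u, v) = ⟨u, v⟩ H(q)`. -/
def IsUmbilicAt (gP : SmoothMetric k P) (gM : SmoothMetric n M) (f : P → M) (q : P) : Prop :=
  ∀ u v : TangentSpace (𝓡 k) q,
    secondFundamentalForm gP gM f q u v = gP.inner q u v • meanCurvatureVector gP gM f q

/-- `N` is a unit vector of `T_{f q} M` normal to the immersion `f`. -/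
def IsUnitNormal (_gP : SmoothMetric k P) (gM : SmoothMetric n M) (f : P → M) (q : P)
    (N : TangentSpace (𝓡 n) (f q)) : Prop :=
  gM.inner (f q) N N = 1 ∧
    ∀ u : TangentSpace (𝓡 k) q, gM.inner (f q) (mfderiv (𝓡 k) (𝓡 n) f q u) N = 0

/-- The mean curvature of a hypersurface at `q` with respect to the unit normal `N`: the number `h`
with `H(q) = h N`, that is, `h = ⟨H(q), N⟩`. -/
def meanCurvature (gP : SmoothMetric k P) (gM : SmoothMetric n M) (f : P → M) (q : P)
    (N : TangentSpace (𝓡 n) (f q)) : ℝ :=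
  gM.inner (f q) (meanCurvatureVector gP gM f q) N

/-- The Weingarten operator `A` of a hypersurface at `q` with respect to the unit normal `N`,
determined by `⟨A u, v⟩ = ⟨II(u, v), N⟩`; its matrix in the coordinate basis of `T_q P` is
`(g_ij)⁻¹ (⟨II(∂_i, ∂_j), N⟩)`. -/
def weingarten (gP : SmoothMetric k P) (gM : SmoothMetric n M) (f : P → M) (q : P)
    (N : TangentSpace (𝓡 n) (f q)) : Module.End ℝ (TangentSpace (𝓡 k) q) :=
  (Matrix.toLin (EuclideanSpace.basisFun (Fin k) ℝ).toBasis
    (EuclideanSpace.basisFun (Fin k) ℝ).toBasis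
    ((gramAt gP q)⁻¹ * Matrix.of fun i j ↦
      gM.inner (f q) (secondFundamentalForm gP gM f q (coordVec q i) (coordVec q j)) N) :
    Model k →ₗ[ℝ] Model k)

/-- Let `j : M → N` and `f : P → N` be immersed submanifolds of the same manifold. The manifold `S`,
with the maps `ι : S → M` and `κ : S → P`, is the intersection of the two submanifolds near the
point `o` of `S`: it is embedded in `M × P` by `(ι, κ)`, its points lie in the fibre product
`{(a, b) | j a = f b}`, and they fill the fibre product near `(ι o, κ o)`. (When `j` and `f` are
inclusions, the fibre product is `M ∩ P`.) -/
structure IsIntersectionAt {S M P N : Type*} [TopologicalSpace S] [TopologicalSpace M]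
    [TopologicalSpace P] (j : M → N) (f : P → N) (ι : S → M) (κ : S → P) (o : S) : Prop where
  comm : ∀ x, j (ι x) = f (κ x)
  embedding : Topology.IsEmbedding fun x ↦ (ι x, κ x)
  fills : ∀ᶠ ab : M × P in 𝓝 (ι o, κ o), j ab.1 = f ab.2 → ∃ x, ι x = ab.1 ∧ κ x = ab.2

end Immersion

end Umbilic

end

open Umbilic

noncomputable section

namespace Umbilic

/-! In the eigenbasis the scalar second fundamental form of Σ at q is diagonal, with the principal
curvatures `μ i` as entries. The mean curvature of each section S_α in M_α is the average of the `μ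
i` over α. Equality of all these averages, with 0 < s < m, forces all `μ i` to coincide: exchange
one index of α for another (`eq_of_forall_sum_eq`). The form is then a multiple of the metric, and
since the normal space of Σ is the line through ν, q is umbilic
(`isUmbilicAt_of_scalarSecondForm_eq`).

The geometric content is the average formula `meanCurvature_section`. A geodesic of M_α starts at q
in every direction; comparing its equation with that of its image in the ambient manifold shows that
the second fundamental form of M_α vanishes on the diagonal
(`TotallyGeodesicAt.secondDeriv_add_christoffelVec`). Differentiating j ∘ ι = f ∘ κ twice then
identifies the form of S_α in M_α with the restriction of that of Σ
(`scalarSecondForm_eq_of_totallyGeodesicAt`). A dimension count shows that the vectors of α span the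
tangent space of S_α (`exists_coordDeriv_eq`).

All computations take place in charts centred at the points concerned. The derivative of such a
chart at its centre is the identity, so tangent vectors there are their own coordinates. -/

theorem two_le_infty : (2 : ℕ∞ω) ≤ ∞ :=
  WithTop.coe_le_coe.2 (le_top (a := (2 : ℕ∞)))

/-! ### Second derivatives in normed spaces -/

/-- The second derivative `D²G(u, v)` at `a`. -/
def secondDeriv {E F : Type*} [NormedAddCommGroup E] [NormedSpace ℝ E] [NormedAddCommGroup F]
    [NormedSpace ℝ F] (G : E → F) (a u v : E) : F :=
  fderiv ℝ (fun y ↦ fderiv ℝ G y v) a u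

section SecondDeriv

variable {E F H : Type*} [NormedAddCommGroup E] [NormedSpace ℝ E] [NormedAddCommGroup F]
  [NormedSpace ℝ F] [NormedAddCommGroup H] [NormedSpace ℝ H]

/-- The left side is what differentiating a field with constant coordinates produces; the right side
is visibly bilinear. -/
theorem secondDeriv_eq {G : E → F} {a : E} (hG : ContDiffAt ℝ 2 G a) (u v : E) :
    secondDeriv G a u v = fderiv ℝ (fderiv ℝ G) a u v := by
  have h : DifferentiableAt ℝ (fderiv ℝ G) a :=
    (hG.fderiv_right (m := 1) (by norm_num)).differentiableAt (by norm_num)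
  have := h.hasFDerivAt.clm_apply (hasFDerivAt_const v a)
  simp [secondDeriv, this.fderiv]

theorem secondDeriv_congr {G G' : E → F} {a : E} (h : G =ᶠ[𝓝 a] G') (u v : E) :
    secondDeriv G a u v = secondDeriv G' a u v := by
  have : (fun y ↦ fderiv ℝ G y v) =ᶠ[𝓝 a] fun y ↦ fderiv ℝ G' y v := by
    filter_upwards [h.fderiv (𝕜 := ℝ)] with y hy
    rw [hy]
  rw [secondDeriv, secondDeriv, this.fderiv_eq]

theorem secondDeriv_comp {G : F → H} {K : E → F} {a : E} (hG : ContDiffAt ℝ 2 G (K a))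
    (hK : ContDiffAt ℝ 2 K a) (u v : E) :
    secondDeriv (fun x ↦ G (K x)) a u v =
      secondDeriv G (K a) (fderiv ℝ K a u) (fderiv ℝ K a v) +
        fderiv ℝ G (K a) (secondDeriv K a u v) := by
  have hG1 : ∀ᶠ z in 𝓝 (K a), DifferentiableAt ℝ G z :=
    (hG.eventually (by simp)).mono fun z hz ↦ hz.differentiableAt (by norm_num)
  have hK1 : ∀ᶠ z in 𝓝 a, DifferentiableAt ℝ K z :=
    (hK.eventually (by simp)).mono fun z hz ↦ hz.differentiableAt (by norm_num)
  have hd : (fun y ↦ fderiv ℝ (fun x ↦ G (K x)) y v) =ᶠ[𝓝 a]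
      fun y ↦ fderiv ℝ G (K y) (fderiv ℝ K y v) := by
    filter_upwards [hK.continuousAt.eventually hG1, hK1] with y h1 h2
    have := fderiv_comp y h1 h2
    rw [Function.comp_def] at this
    rw [this]
    rfl
  have hG2 : DifferentiableAt ℝ (fderiv ℝ G) (K a) :=
    (hG.fderiv_right (m := 1) (by norm_num)).differentiableAt (by norm_num)
  have hK2 : DifferentiableAt ℝ (fderiv ℝ K) a :=
    (hK.fderiv_right (m := 1) (by norm_num)).differentiableAt (by norm_num)
  have hK3 : HasFDerivAt K (fderiv ℝ K a) a := (hK.differentiableAt (by norm_num)).hasFDerivAt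
  have h1 : HasFDerivAt (fun y ↦ fderiv ℝ G (K y)) _ a := hG2.hasFDerivAt.comp a hK3
  have h2 : HasFDerivAt (fun y ↦ fderiv ℝ K y v) _ a :=
    hK2.hasFDerivAt.clm_apply (hasFDerivAt_const v a)
  rw [secondDeriv_eq hG, secondDeriv_eq hK, secondDeriv, hd.fderiv_eq, (h1.clm_apply h2).fderiv]
  simp [add_comm]

theorem deriv_deriv_comp {G : E → F} {c : ℝ → E} {t : ℝ} (hG : ContDiffAt ℝ 2 G (c t))
    (hc : ContDiffAt ℝ 2 c t) :
    deriv (deriv fun τ ↦ G (c τ)) t =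
      secondDeriv G (c t) (deriv c t) (deriv c t) + fderiv ℝ G (c t) (deriv (deriv c) t) :=
  -- `deriv` is `fderiv` applied to 1, so this is an instance by definition.
  secondDeriv_comp hG hc 1 1

end SecondDeriv

/-! ### Maps and covariant derivatives in centred charts -/

section Coordinates

variable {k : ℕ} {P : Type*} [TopologicalSpace P] [ChartedSpace (Model k) P]
  {n : ℕ} {M : Type*} [TopologicalSpace M] [ChartedSpace (Model n) M]

/-- The map `f` in the charts centred at `x` and at `f x`. -/
def coordRep (f : P → M) (x : P) (y : Model k) : Model n :=
  chartAt (Model n) (f x) (f ((chartAt (Model k) x).symm y))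

theorem coordRep_center (f : P → M) (x : P) :
    coordRep f x (chartAt (Model k) x x) = chartAt (Model n) (f x) (f x) := by
  simp [coordRep]

theorem contDiffAt_coordRep {f : P → M} {x : P} {r : ℕ∞ω}
    (hf : ContMDiffAt (𝓡 k) (𝓡 n) r f x) :
    ContDiffAt ℝ r (coordRep f x : _ → Model n) (chartAt (Model k) x x) := by
  have h := (contMDiffAt_iff.1 hf).2
  have hr : Set.range (𝓡 k) = Set.univ := (𝓡 k).range_eq_univ
  rw [hr, contDiffWithinAt_univ] at h
  exact h

theorem mfderiv_eq_fderiv_coordRep {f : P → M} {x : P}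
    (hf : MDifferentiableAt (𝓡 k) (𝓡 n) f x) :
    mfderiv (𝓡 k) (𝓡 n) f x = fderiv ℝ (coordRep f x) (chartAt (Model k) x x) := by
  have h : mfderiv (𝓡 k) (𝓡 n) f x =
      fderivWithin ℝ (writtenInExtChartAt (𝓡 k) (𝓡 n) x f) (Set.range (𝓡 k))
        (extChartAt (𝓡 k) x x) := if_pos hf
  refine h.trans ?_
  have hr : Set.range (𝓡 k) = Set.univ := (𝓡 k).range_eq_univ
  rw [hr, fderivWithin_univ]
  rfl

variable [IsManifold (𝓡 k) ∞ P] [IsManifold (𝓡 n) ∞ M]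

theorem mfderiv_chartAt_self (x : P) :
    mfderiv (𝓡 k) (𝓡 k) (chartAt (Model k) x) x = ContinuousLinearMap.id ℝ (Model k) :=
  mfderiv_extChartAt_self (I := 𝓡 k) (x := x)

/-- The extension is constant in the trivialization at x, whose inverse is the derivative of the
inverse chart: the field has constant coordinates v. -/
theorem extend_eq_mfderiv_symm {x y : P} (hy : y ∈ (chartAt (Model k) x).source)
    (v : TangentSpace (𝓡 k) x) :
    FiberBundle.extend (E := fun x : P ↦ TangentSpace (𝓡 k) x) (Model k) v y =
      mfderiv (𝓡 k) (𝓡 k) (chartAt (Model k) x).symm (chartAt (Model k) x y) v := by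
  have h1 := TangentBundle.symmL_trivializationAt (I := 𝓡 k) hy
  have h2 : ((trivializationAt (Model k) (TangentSpace (𝓡 k)) x) ⟨x, v⟩).2 = v := by
    have := TangentBundle.continuousLinearMapAt_trivializationAt (I := 𝓡 k) (mem_chart_source (Model k) x)
    rw [mfderiv_extChartAt_self] at this
    have h := congrArg (fun L ↦ L v) this
    refine Eq.trans ?_ h
    exact (Bundle.Trivialization.coe_linearMapAt_of_mem (R := ℝ)
      (trivializationAt (Model k) (TangentSpace (𝓡 k)) x)
      (by exact FiberBundle.mem_baseSet_trivializationAt' x) ▸ rfl)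
  have h3 := congrArg (fun L ↦ L v) h1
  have h4 : FiberBundle.extend (E := fun x : P ↦ TangentSpace (𝓡 k) x) (Model k) v y =
      (trivializationAt (Model k) (TangentSpace (𝓡 k)) x).symm y v :=
    congrArg (fun w ↦ (trivializationAt (Model k) (TangentSpace (𝓡 k)) x).symm y w) h2
  have h5 := Bundle.Trivialization.symmL_apply (R := ℝ)
    (trivializationAt (Model k) (TangentSpace (𝓡 k)) x) (b := y) (by simpa using hy) v
  have hr : Set.range (𝓡 k) = Set.univ := (𝓡 k).range_eq_univ
  rw [hr, mfderivWithin_univ] at h3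
  exact h4.trans (h5.symm.trans h3)

theorem mfderiv_chart_mfderiv_extend {f : P → M} (hf : ContMDiff (𝓡 k) (𝓡 n) ∞ f) {x y : P}
    (hy : y ∈ (chartAt (Model k) x).source) (hfy : f y ∈ (chartAt (Model n) (f x)).source)
    (v : TangentSpace (𝓡 k) x) :
    mfderiv (𝓡 n) (𝓡 n) (chartAt (Model n) (f x)) (f y) (mfderiv (𝓡 k) (𝓡 n) f y
      (FiberBundle.extend (E := fun x : P ↦ TangentSpace (𝓡 k) x) (Model k) v y)) =
    fderiv ℝ (coordRep f x) (chartAt (Model k) x y) v := by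
  rw [extend_eq_mfderiv_symm hy, ← mfderiv_eq_fderiv]
  have hz : chartAt (Model k) x y ∈ (chartAt (Model k) x).target :=
    (chartAt (Model k) x).map_source hy
  have hsy : (chartAt (Model k) x).symm (chartAt (Model k) x y) = y :=
    (chartAt (Model k) x).left_inv hy
  have h1 : MDifferentiableAt (𝓡 k) (𝓡 k) (chartAt (Model k) x).symm (chartAt (Model k) x y) :=
    mdifferentiableAt_atlas_symm (chart_mem_atlas _ x) hz
  have h2 : MDifferentiableAt (𝓡 k) (𝓡 n) f y := (hf y).mdifferentiableAt (by simp)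
  have h3 : MDifferentiableAt (𝓡 n) (𝓡 n) (chartAt (Model n) (f x)) (f y) :=
    mdifferentiableAt_atlas (chart_mem_atlas _ (f x)) hfy
  have h4 := HasMFDerivAt.comp (chartAt (Model k) x y) (g := f) (f := (chartAt (Model k) x).symm)
    (g' := mfderiv (𝓡 k) (𝓡 n) f y) (by rw [hsy]; exact h2.hasMFDerivAt) h1.hasMFDerivAt
  have h5 := HasMFDerivAt.comp (chartAt (Model k) x y) (g := chartAt (Model n) (f x))
    (g' := mfderiv (𝓡 n) (𝓡 n) (chartAt (Model n) (f x)) (f y))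
    (by rw [Function.comp_apply, hsy]; exact h3.hasMFDerivAt) h4
  exact (congrArg (fun L ↦ L v) h5.mfderiv).symm

/-- Near x the field reads D(`coordRep f x`)(·)v in the chart, so its derivative is a second
derivative. The chart derivatives at the centres are identities and disappear. -/
theorem covDeriv_mfderiv_extend (gM : SmoothMetric n M) {f : P → M}
    (hf : ContMDiff (𝓡 k) (𝓡 n) ∞ f) (x : P) (u v : TangentSpace (𝓡 k) x) :
    covDeriv gM f (fun x ↦ mfderiv (𝓡 k) (𝓡 n) f x
        (FiberBundle.extend (E := fun x : P ↦ TangentSpace (𝓡 k) x) (Model k) v x)) x u =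
      secondDeriv (coordRep f x) (chartAt (Model k) x x) u v +
        christoffelVec gM (f x) (chartAt (Model n) (f x) (f x))
          (mfderiv (𝓡 k) (𝓡 n) f x u) (mfderiv (𝓡 k) (𝓡 n) f x v) := by
  have hev : (fun y : P ↦ (mfderiv (𝓡 n) (𝓡 n) (chartAt (Model n) (f x)) (f y)
      (mfderiv (𝓡 k) (𝓡 n) f y
      (FiberBundle.extend (E := fun x : P ↦ TangentSpace (𝓡 k) x) (Model k) v y)) : Model n))
      =ᶠ[𝓝 x] fun y ↦ fderiv ℝ (coordRep f x) (chartAt (Model k) x y) v := by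
    filter_upwards [(chartAt (Model k) x).open_source.mem_nhds (mem_chart_source _ x),
      hf.continuous.continuousAt ((chartAt (Model n) (f x)).open_source.mem_nhds
        (mem_chart_source _ (f x)))] with y h1 h2
    exact mfderiv_chart_mfderiv_extend hf h1 h2 v
  have hd : mfderiv (𝓡 k) 𝓘(ℝ, Model n)
      (fun y : P ↦ fderiv ℝ (coordRep f x : _ → Model n) (chartAt (Model k) x y) v) x u =
      secondDeriv (coordRep f x) (chartAt (Model k) x x) u v := by
    have hF : ContDiffAt ℝ 2 (coordRep f x : _ → Model n) (chartAt (Model k) x x) :=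
      contDiffAt_coordRep ((hf x).of_le two_le_infty)
    have h1 : DifferentiableAt ℝ (fun z ↦ fderiv ℝ (coordRep f x : _ → Model n) z v) (chartAt (Model k) x x) :=
      ((hF.fderiv_right (m := 1) (by norm_num)).differentiableAt (by norm_num)).clm_apply
        (differentiableAt_const v)
    have h2 : MDifferentiableAt (𝓡 k) (𝓡 k) (chartAt (Model k) x) x :=
      mdifferentiableAt_atlas (chart_mem_atlas _ x) (mem_chart_source _ x)
    have h3 := h1.hasFDerivAt.hasMFDerivAt.comp x h2.hasMFDerivAt
    have h4 := congrArg (fun L ↦ L u) h3.mfderiv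
    refine h4.trans ?_
    rw [mfderiv_chartAt_self]
    rfl
  unfold covDeriv
  simp only [mfderiv_chartAt_self, hev.mfderiv_eq, FiberBundle.extend_apply_self]
  exact (congrArg (fun L : Model n →L[ℝ] Model n ↦ L _) ContinuousLinearMap.inverse_id).trans
    (congrArg (· + _) hd)

end Coordinates

/-! ### Smoothness of the metric coefficients -/

section LeviCivitaLemmas

variable {n : ℕ} {M : Type*} [TopologicalSpace M] [ChartedSpace (Model n) M]
  [IsManifold (𝓡 n) ∞ M]

/-- This is the tangent map of the inverse chart composed with the smooth constant field z ↦ (z, v).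
-/
theorem contMDiffAt_mfderiv_chart_symm (p : M) {y : Model n}
    (hy : y ∈ (chartAt (Model n) p).target) (v : Model n) :
    ContMDiffAt (𝓡 n) (𝓡 n).tangent ∞ (fun z ↦ (⟨(chartAt (Model n) p).symm z,
      mfderiv (𝓡 n) (𝓡 n) (chartAt (Model n) p).symm z v⟩ : TangentBundle (𝓡 n) M)) y := by
  have h1 : ContMDiffOn (𝓡 n) (𝓡 n) ∞ (chartAt (Model n) p).symm (chartAt (Model n) p).target :=
    contMDiffOn_chart_symm
  have ho := (chartAt (Model n) p).open_target
  have h2 := h1.contMDiffOn_tangentMapWithin (m := ∞) (by simp) ho.uniqueMDiffOn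
  have h3 : ContMDiffAt (𝓡 n) (𝓡 n).tangent ∞
      (fun z : Model n ↦ (⟨z, v⟩ : TangentBundle (𝓡 n) (Model n))) y :=
    contMDiffAt_vectorSpace_iff_contDiffAt.2 contDiffAt_const
  have hpre : IsOpen (Bundle.TotalSpace.proj (F := Model n) (E := (TangentSpace (𝓡 n) : Model n → Type)) ⁻¹'
      (chartAt (Model n) p).target) := ho.preimage (FiberBundle.continuous_proj _ _)
  have h4 := (h2.contMDiffAt (hpre.mem_nhds (x := ⟨y, v⟩) hy)).comp y h3
  refine h4.congr_of_eventuallyEq ?_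
  filter_upwards [ho.mem_nhds hy] with z hz
  simp only [Function.comp_apply, tangentMapWithin]
  rw [mfderivWithin_of_isOpen ho hz]

theorem contDiffAt_gram (g : SmoothMetric n M) (p : M) {y : Model n}
    (hy : y ∈ (chartAt (Model n) p).target) (i j : Fin n) :
    ContDiffAt ℝ ∞ (fun z ↦ gram g p z i j) y := by
  have h1 := contMDiffAt_mfderiv_chart_symm p hy (stdVec i)
  have h2 := contMDiffAt_mfderiv_chart_symm p hy (stdVec j)
  have h0 : ContMDiffAt (𝓡 n) (𝓡 n) ∞ (chartAt (Model n) p).symm y :=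
    contMDiffOn_chart_symm.contMDiffAt ((chartAt (Model n) p).open_target.mem_nhds hy)
  have h3 := g.contMDiff.contMDiffAt.comp y h0
  have h4 := ContMDiffAt.clm_bundle_apply₂ (F₁ := Model n) (F₂ := Model n) (F₃ := ℝ)
    (E₃ := Bundle.Trivial M ℝ) h3 h1 h2
  simp only [Bundle.contMDiffAt_totalSpace] at h4
  exact h4.2.contDiffAt

end LeviCivitaLemmas

/-! ### Invertibility of Gram matrices and smoothness of the inverse -/

/-- A kernel vector v of the Gram matrix would make ∑ v_i b_i isotropic, hence zero, contradicting
independence. -/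
theorem det_bilin_ne_zero {ι V : Type*} [Fintype ι] [DecidableEq ι] [AddCommGroup V] [Module ℝ V]
    (B : V →ₗ[ℝ] V →ₗ[ℝ] ℝ) (hB : ∀ v, v ≠ 0 → 0 < B v v) {b : ι → V}
    (hb : LinearIndependent ℝ b) : (Matrix.of fun i j ↦ B (b i) (b j)).det ≠ 0 := by
  intro h
  obtain ⟨v, hv, h0⟩ := Matrix.exists_mulVec_eq_zero_iff.2 h
  have h1 : B (∑ i, v i • b i) (∑ i, v i • b i) = 0 := by
    have h2 (i) : B (b i) (∑ j, v j • b j) = 0 := by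
      have := congrFun h0 i
      simp only [Matrix.mulVec, dotProduct, Matrix.of_apply, Pi.zero_apply] at this
      rw [map_sum, ← this]
      simp [mul_comm]
    have h3 (w : V) : B (∑ i, v i • b i) w = ∑ i, v i * B (b i) w := by
      simp [LinearMap.sum_apply]
    simp only [h3, h2, mul_zero, Finset.sum_const_zero]
  by_cases h3 : ∑ i, v i • b i = 0
  · exact hv (funext (Fintype.linearIndependent_iff.1 hb v h3))
  · exact (hB _ h3).ne' h1

theorem contDiffAt_det {ι E : Type*} [Fintype ι] [DecidableEq ι] [NormedAddCommGroup E]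
    [NormedSpace ℝ E] {A : E → Matrix ι ι ℝ} {a : E} {r : ℕ∞ω}
    (hA : ∀ i j, ContDiffAt ℝ r (fun y ↦ A y i j) a) : ContDiffAt ℝ r (fun y ↦ (A y).det) a := by
  simp only [Matrix.det_apply']
  exact ContDiffAt.sum fun σ _ ↦ contDiffAt_const.mul (contDiffAt_prod fun i _ ↦ hA _ _)

/-- By Cramer's rule the entries are quotients of determinants. -/
theorem contDiffAt_matrix_inv {ι E : Type*} [Fintype ι] [DecidableEq ι] [NormedAddCommGroup E]
    [NormedSpace ℝ E] {A : E → Matrix ι ι ℝ} {a : E} {r : ℕ∞ω}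
    (hA : ∀ i j, ContDiffAt ℝ r (fun y ↦ A y i j) a) (h : (A a).det ≠ 0) (i j : ι) :
    ContDiffAt ℝ r (fun y ↦ (A y)⁻¹ i j) a := by
  simp only [Matrix.inv_def, Matrix.smul_apply, Ring.inverse_eq_inv', Matrix.adjugate_apply,
    smul_eq_mul]
  refine ((contDiffAt_det hA).inv h).mul (contDiffAt_det fun k l ↦ ?_)
  by_cases hk : k = j
  · subst hk
    simpa [Matrix.updateRow_self] using contDiffAt_const
  · simpa [Matrix.updateRow_ne hk] using hA k l

/-! ### Christoffel symbols and existence of geodesics -/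

section LeviCivitaLemmas

variable {n : ℕ} {M : Type*} [TopologicalSpace M] [ChartedSpace (Model n) M]
  [IsManifold (𝓡 n) ∞ M]

/-- The metric at `x` as a bilinear map. -/
def bilin (g : SmoothMetric n M) (x : M) : Model n →ₗ[ℝ] Model n →ₗ[ℝ] ℝ :=
  LinearMap.mk₂ ℝ (fun u v ↦ g.inner x u v)
    (fun u u' v ↦ congrArg (fun L ↦ L v) ((g.inner x).map_add u u'))
    (fun r u v ↦ congrArg (fun L ↦ L v) ((g.inner x).map_smul r u))
    (fun u v v' ↦ (g.inner x u).map_add v v') (fun r u v ↦ (g.inner x u).map_smul r v)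

theorem bilin_pos (g : SmoothMetric n M) (x : M) (v : Model n) (hv : v ≠ 0) :
    0 < bilin g x v v := g.pos x v hv

theorem bilin_comm (g : SmoothMetric n M) (x : M) (u v : Model n) :
    bilin g x u v = bilin g x v u := g.symm x u v

theorem linearIndependent_stdVec (n : ℕ) :
    LinearIndependent ℝ (fun i : Fin n ↦ (stdVec i : Model n)) := by
  have := (EuclideanSpace.basisFun (Fin n) ℝ).toBasis.linearIndependent
  convert! this using 1
  ext i : 1
  simp

theorem det_gramAt_ne_zero (g : SmoothMetric n M) (x : M) : (gramAt g x).det ≠ 0 :=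
  det_bilin_ne_zero (bilin g x) (bilin_pos g x) (linearIndependent_stdVec n)

theorem det_gram_ne_zero (g : SmoothMetric n M) (p : M) {y : Model n}
    (hy : y ∈ (chartAt (Model n) p).target) : (gram g p y).det ≠ 0 := by
  have h1 : Function.Injective (mfderiv (𝓡 n) (𝓡 n) (chartAt (Model n) p).symm y) :=
    (mdifferentiable_chart (I := 𝓡 n) p).symm.mfderiv_injective hy
  let L : Model n →L[ℝ] Model n := mfderiv (𝓡 n) (𝓡 n) (chartAt (Model n) p).symm y
  exact det_bilin_ne_zero (bilin g ((chartAt (Model n) p).symm y)) (bilin_pos g _)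
    ((linearIndependent_stdVec n).map' L.toLinearMap (LinearMap.ker_eq_bot.2 h1))

theorem contDiffAt_dGram (g : SmoothMetric n M) (p : M) {y : Model n}
    (hy : y ∈ (chartAt (Model n) p).target) (l i j : Fin n) :
    ContDiffAt ℝ ∞ (fun z ↦ dGram g p z l i j) y :=
  ((contDiffAt_gram g p hy i j).fderiv_right (m := ∞) (by simp)).clm_apply contDiffAt_const

theorem contDiffAt_christoffel (g : SmoothMetric n M) (p : M) {y : Model n}
    (hy : y ∈ (chartAt (Model n) p).target) (i j k : Fin n) :
    ContDiffAt ℝ ∞ (fun z ↦ christoffel g p z i j k) y :=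
  contDiffAt_const.mul (ContDiffAt.sum fun l _ ↦
    (contDiffAt_matrix_inv (contDiffAt_gram g p hy) (det_gram_ne_zero g p hy) k l).mul
      (((contDiffAt_dGram g p hy i j l).add (contDiffAt_dGram g p hy j i l)).sub
        (contDiffAt_dGram g p hy l i j)))

/-- The vector field on `ℝⁿ × ℝⁿ` whose integral curves are the geodesics in the chart centred
at `p`, together with their velocities. -/
def geodesicSpray (g : SmoothMetric n M) (p : M) (z : Model n × Model n) : Model n × Model n :=
  (z.2, -christoffelVec g p z.1 z.2 z.2)

theorem contDiffAt_geodesicSpray (g : SmoothMetric n M) (p : M) {z : Model n × Model n}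
    (hz : z.1 ∈ (chartAt (Model n) p).target) : ContDiffAt ℝ ∞ (geodesicSpray g p) z := by
  refine contDiffAt_snd.prodMk (ContDiffAt.neg ?_)
  rw [contDiffAt_piLp]
  intro k
  have h (i : Fin n) : ContDiffAt ℝ ∞ (fun y : Model n × Model n ↦ y.2 i) z :=
    (contDiffAt_piLp 2).1 contDiffAt_snd i
  change ContDiffAt ℝ ∞ (fun y : Model n × Model n ↦
    ∑ i, ∑ j, christoffel g p y.1 i j k * y.2 i * y.2 j) z
  exact ContDiffAt.sum fun i _ ↦ ContDiffAt.sum fun j _ ↦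
    (((contDiffAt_christoffel g p hz i j k).comp z contDiffAt_fst).mul (h i)).mul (h j)

/-- Picard–Lindelöf applied to the geodesic spray at (p, w), in the chart centred at p. -/
theorem exists_isGeodesicAt (g : SmoothMetric n M) (p : M) (w : Model n) :
    ∃ c : ℝ → M, c 0 = p ∧ IsGeodesicAt g c 0 ∧
      deriv (fun t ↦ chartAt (Model n) p (c t)) 0 = w := by
  have hp : chartAt (Model n) p p ∈ (chartAt (Model n) p).target := mem_chart_target _ p
  have hX : ContDiffAt ℝ 1 (geodesicSpray g p) (chartAt (Model n) p p, w) :=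
    (contDiffAt_geodesicSpray g p hp).of_le (by simp)
  obtain ⟨α, hα0, ε, hε, hα⟩ :=
    hX.exists_forall_mem_closedBall_exists_eq_forall_mem_Ioo_hasDerivAt₀ 0
  have hα' : ∀ᶠ t in 𝓝 (0 : ℝ), HasDerivAt α (geodesicSpray g p (α t)) t :=
    Filter.eventually_of_mem (Ioo_mem_nhds (by linarith) (by linarith)) hα
  have hcont : ContinuousAt α 0 := hα'.self_of_nhds.continuousAt
  -- The integral curve is differentiable, and its derivative, the spray along the curve, is
  -- continuous.
  have hα1 : ContDiffAt ℝ 1 α 0 := by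
    rw [contDiffAt_one_iff]
    have h2 : ∀ᶠ t in 𝓝 (0 : ℝ), ContDiffAt ℝ 1 (geodesicSpray g p) (α t) :=
      hcont.eventually (by rw [hα0]; exact hX.eventually (by simp))
    refine ⟨fun t ↦ ContinuousLinearMap.toSpanSingleton ℝ (geodesicSpray g p (α t)), _,
      hα'.and h2, fun t ht ↦ ContinuousAt.continuousWithinAt ?_, fun t ht ↦ ht.1.hasFDerivAt⟩
    exact (ContinuousLinearMap.toSpanSingletonCLE (𝕜 := ℝ)
      (E := Model n × Model n)).continuous.continuousAt.comp
      (ContinuousAt.comp ht.2.continuousAt ht.1.continuousAt)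
  have hx1 : ∀ᶠ t in 𝓝 (0 : ℝ), HasDerivAt (fun t ↦ (α t).1) (α t).2 t :=
    hα'.mono fun t ht ↦ ht.fst
  have hv1 : ∀ᶠ t in 𝓝 (0 : ℝ), HasDerivAt (fun t ↦ (α t).2)
      (-christoffelVec g p (α t).1 (α t).2 (α t).2) t :=
    hα'.mono fun t ht ↦ ht.snd
  -- The derivative of the position is the velocity, which is C¹; this gains the order of smoothness
  -- that `IsGeodesicAt` demands.
  have hx2 : ContDiffAt ℝ 2 (fun t ↦ (α t).1) 0 := by
    have : ContDiffAt ℝ ((1 : ℕ) + 1) (fun t ↦ (α t).1) 0 := by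
      rw [contDiffAt_succ_iff_hasFDerivAt]
      refine ⟨fun t ↦ ContinuousLinearMap.toSpanSingleton ℝ (α t).2,
        ⟨_, hx1, fun t ht ↦ HasDerivAt.hasFDerivAt ht⟩, ?_⟩
      exact (ContinuousLinearMap.toSpanSingletonCLE (𝕜 := ℝ)
        (E := Model n)).contDiff.contDiffAt.comp 0 (by exact_mod_cast hα1.snd)
    exact_mod_cast this
  have hxt : ∀ᶠ t in 𝓝 (0 : ℝ), (α t).1 ∈ (chartAt (Model n) p).target :=
    hx2.continuousAt ((chartAt (Model n) p).open_target.mem_nhds (by rw [hα0]; exact hp))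
  have hφ : (fun t ↦ chartAt (Model n) p ((chartAt (Model n) p).symm (α t).1)) =ᶠ[𝓝 0]
      fun t ↦ (α t).1 :=
    hxt.mono fun t ht ↦ (chartAt (Model n) p).right_inv ht
  have hc0 : (chartAt (Model n) p).symm (α 0).1 = p := by simp [hα0]
  refine ⟨fun t ↦ (chartAt (Model n) p).symm (α t).1, hc0, ⟨?_, ?_⟩, ?_⟩
  · have h1 : ContMDiffAt (𝓡 n) (𝓡 n) 2 (chartAt (Model n) p).symm (α 0).1 := by
      refine (contMDiffOn_chart_symm (n := ∞)).contMDiffAt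
        ((chartAt (Model n) p).open_target.mem_nhds ?_) |>.of_le two_le_infty
      rw [hα0]
      exact hp
    exact h1.comp 0 hx2.contMDiffAt
  · dsimp only
    rw [hc0]
    have hd : (deriv fun t ↦ chartAt (Model n) p ((chartAt (Model n) p).symm (α t).1)) =ᶠ[𝓝 0]
        fun t ↦ (α t).2 :=
      hφ.deriv.trans (hx1.mono fun t ht ↦ ht.deriv)
    filter_upwards [hd, hd.deriv, hφ, hv1] with t h1 h2 h3 h4
    rw [h1, h2, h3, h4.deriv, neg_add_cancel]
  · rw [hφ.deriv_eq, hx1.self_of_nhds.deriv, hα0]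

end LeviCivitaLemmas

/-! ### Vanishing of the second fundamental form at a totally geodesic point -/

/-- Take a geodesic c with initial velocity w. Both c and f ∘ c satisfy their geodesic equations at
time 0, and the chain rule expresses (f ∘ c)'' through c'' = -Γ(w, w). -/
theorem TotallyGeodesicAt.secondDeriv_add_christoffelVec {k : ℕ} {P : Type*} [TopologicalSpace P]
    [ChartedSpace (Model k) P] [IsManifold (𝓡 k) ∞ P]
    {n : ℕ} {M : Type*} [TopologicalSpace M] [ChartedSpace (Model n) M] [IsManifold (𝓡 n) ∞ M]
    {gP : SmoothMetric k P} {gM : SmoothMetric n M} {f : P → M} {p : P}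
    (h : TotallyGeodesicAt gP gM f p) (hf : ContMDiff (𝓡 k) (𝓡 n) ∞ f) (w : Model k) :
    secondDeriv (coordRep f p) (chartAt (Model k) p p) w w +
      christoffelVec gM (f p) (chartAt (Model n) (f p) (f p))
        (fderiv ℝ (coordRep f p) (chartAt (Model k) p p) w)
        (fderiv ℝ (coordRep f p) (chartAt (Model k) p p) w) =
    fderiv ℝ (coordRep f p) (chartAt (Model k) p p)
      (christoffelVec gP p (chartAt (Model k) p p) w w) := by
  obtain ⟨c, hc0, hc, hw⟩ := exists_isGeodesicAt gP p w
  have hfc := (h c hc0 hc).2.self_of_nhds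
  have hc1 := hc.2.self_of_nhds
  have hx : ContDiffAt ℝ 2 (fun t ↦ chartAt (Model k) p (c t)) 0 := by
    have h1 : ContMDiffAt (𝓡 k) (𝓡 k) 2 (chartAt (Model k) p) (c 0) := by
      rw [hc0]
      exact ((contMDiffOn_chart (n := ∞)).contMDiffAt ((chartAt (Model k) p).open_source.mem_nhds
        (mem_chart_source _ p))).of_le two_le_infty
    exact (h1.comp 0 hc.1).contDiffAt
  rw [hc0, hw] at hc1
  have hev : (fun t ↦ chartAt (Model n) (f p) (f (c t))) =ᶠ[𝓝 0]
      fun t ↦ coordRep f p (chartAt (Model k) p (c t)) := by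
    have : ∀ᶠ t in 𝓝 (0 : ℝ), c t ∈ (chartAt (Model k) p).source :=
      hc.1.continuousAt ((chartAt (Model k) p).open_source.mem_nhds
        (by rw [hc0]; exact mem_chart_source _ p))
    filter_upwards [this] with t ht
    simp [coordRep, ht]
  have hF : ContDiffAt ℝ 2 (coordRep f p : _ → Model n) (chartAt (Model k) p (c 0)) := by
    rw [hc0]
    exact contDiffAt_coordRep ((hf p).of_le two_le_infty)
  have hd1 : deriv (fun t ↦ coordRep f p (chartAt (Model k) p (c t)) : ℝ → Model n) 0 =
      fderiv ℝ (coordRep f p) (chartAt (Model k) p p) w := by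
    have := fderiv_comp_deriv (0 : ℝ) (hF.differentiableAt (by norm_num))
      (hx.differentiableAt (by norm_num))
    rw [hw, hc0] at this
    exact this
  simp only [Function.comp_apply, hc0] at hfc
  rw [hev.deriv_eq, hev.deriv.deriv_eq, deriv_deriv_comp hF hx, hd1, hw, hc0,
    eq_neg_of_add_eq_zero_left hc1, map_neg] at hfc
  rw [← sub_eq_zero, ← hfc]
  abel

/-! ### Bilinear forms and orthonormal bases -/

section BilinearForms

variable {ι V : Type*} [AddCommGroup V] [Module ℝ V]

theorem linearIndependent_of_orthonormal [Fintype ι] [DecidableEq ι] (B : V →ₗ[ℝ] V →ₗ[ℝ] ℝ) {b : ι → V}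
    (hb : ∀ i j, B (b i) (b j) = if i = j then 1 else 0) : LinearIndependent ℝ b := by
  rw [Fintype.linearIndependent_iff]
  intro c hc j
  have h := congrArg (fun v ↦ B v (b j)) hc
  simpa [LinearMap.sum_apply, hb] using h

theorem span_eq_top_of_orthonormal [Fintype ι] [DecidableEq ι] [FiniteDimensional ℝ V]
    (B : V →ₗ[ℝ] V →ₗ[ℝ] ℝ) {b : ι → V}
    (hb : ∀ i j, B (b i) (b j) = if i = j then 1 else 0)
    (hc : Fintype.card ι = Module.finrank ℝ V) : Submodule.span ℝ (Set.range b) = ⊤ :=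
  (linearIndependent_of_orthonormal B hb).span_eq_top_of_card_eq_finrank' hc

theorem eq_zero_of_forall_bilin_eq_zero (B : V →ₗ[ℝ] V →ₗ[ℝ] ℝ)
    (hB : ∀ v, v ≠ 0 → 0 < B v v) {b : ι → V} (hb : Submodule.span ℝ (Set.range b) = ⊤) {v : V}
    (h : ∀ i, B v (b i) = 0) : v = 0 := by
  have h1 : B v = 0 := LinearMap.ext_on_range (v := b) hb h
  by_contra h2
  exact (hB v h2).ne' (by rw [h1]; rfl)

theorem bilin_ext {B B' : V →ₗ[ℝ] V →ₗ[ℝ] ℝ} {b : ι → V}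
    (hb : Submodule.span ℝ (Set.range b) = ⊤) (h : ∀ i j, B (b i) (b j) = B' (b i) (b j)) :
    B = B' :=
  LinearMap.ext_on_range (v := b) hb fun i ↦ LinearMap.ext_on_range (v := b) hb (h i)

theorem eq_sum_stdVec {k : ℕ} (v : Model k) : v = ∑ i, v i • (stdVec i : Model k) := by
  ext l
  simp [Pi.single_apply]

theorem linearMap_ext_stdVec {k : ℕ} {L L' : Model k →ₗ[ℝ] V}
    (h : ∀ i, L (stdVec i) = L' (stdVec i)) : L = L' := by
  ext v
  rw [eq_sum_stdVec v]
  simp only [map_sum, map_smul, h]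

theorem bilin_eq_sum {k : ℕ} (h : Model k →ₗ[ℝ] Model k →ₗ[ℝ] ℝ) (u v : Model k) :
    h u v = ∑ i, ∑ j, u i * v j * h (stdVec i) (stdVec j) := by
  conv_lhs => rw [eq_sum_stdVec u, eq_sum_stdVec v]
  simp only [map_sum, LinearMap.sum_apply, map_smul, LinearMap.smul_apply, smul_eq_mul,
    Finset.mul_sum]
  rw [Finset.sum_comm]
  exact Finset.sum_congr rfl fun i _ ↦ Finset.sum_congr rfl fun j _ ↦ by ring

theorem toLin_basisFun_apply {k : ℕ} (A : Matrix (Fin k) (Fin k) ℝ) (u : Model k) :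
    Matrix.toLin (EuclideanSpace.basisFun (Fin k) ℝ).toBasis
      (EuclideanSpace.basisFun (Fin k) ℝ).toBasis A u = ∑ j, A.mulVec u j • (stdVec j : Model k) := by
  rw [Matrix.toLin_apply]
  refine Finset.sum_congr rfl fun j _ ↦ ?_
  congr 1
  simp

/-- The trace of `h` with respect to the scalar product `B`, computed in an orthonormal basis. -/
theorem sum_inv_mul_eq_sum_orthonormal {k : ℕ} (B h : Model k →ₗ[ℝ] Model k →ₗ[ℝ] ℝ)
    {e : Fin k → Model k} (he : ∀ i j, B (e i) (e j) = if i = j then 1 else 0) :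
    ∑ i, ∑ j, (Matrix.of fun i j ↦ B (stdVec i) (stdVec j))⁻¹ i j * h (stdVec i) (stdVec j) =
      ∑ a, h (e a) (e a) := by
  set G : Matrix (Fin k) (Fin k) ℝ := Matrix.of fun i j ↦ B (stdVec i) (stdVec j) with hG
  set E : Matrix (Fin k) (Fin k) ℝ := Matrix.of fun i a ↦ e a i with hE
  -- Orthonormality in matrix form. A one-sided inverse of a square matrix is two-sided, so G⁻¹ = E
  -- Eᵀ.
  have h1 : (E.transpose * G) * E = 1 := by
    ext a b
    rw [Matrix.one_apply, ← he, bilin_eq_sum B, Matrix.mul_apply]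
    simp only [Matrix.mul_apply, Matrix.transpose_apply, hE, hG, Matrix.of_apply, Finset.sum_mul]
    rw [Finset.sum_comm]
    exact Finset.sum_congr rfl fun i _ ↦ Finset.sum_congr rfl fun j _ ↦ by ring
  have h2 : (E * E.transpose) * G = 1 := by
    rw [Matrix.mul_assoc]
    exact mul_eq_one_comm.1 h1
  rw [Matrix.inv_eq_left_inv h2]
  simp_rw [bilin_eq_sum h (e _) (e _)]
  symm
  rw [Finset.sum_comm]
  refine Finset.sum_congr rfl fun i _ ↦ ?_
  rw [Finset.sum_comm]
  refine Finset.sum_congr rfl fun j _ ↦ ?_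
  simp only [Matrix.mul_apply, Matrix.transpose_apply, hE, Matrix.of_apply, Finset.sum_mul]

end BilinearForms

/-! ### Bilinearity of the Christoffel term -/

section Christoffel

variable {n : ℕ} {M : Type*} [TopologicalSpace M] [ChartedSpace (Model n) M]
  [IsManifold (𝓡 n) ∞ M]

/-- The map `(u, v) ↦ Γ(u, v)` as a bilinear map. -/
def christoffelBilin (g : SmoothMetric n M) (p : M) (y : Model n) :
    Model n →ₗ[ℝ] Model n →ₗ[ℝ] Model n :=
  LinearMap.mk₂ ℝ (christoffelVec g p y)
    (fun u u' v ↦ by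
      ext k
      simp [christoffelVec, mul_add, add_mul, Finset.sum_add_distrib])
    (fun r u v ↦ by
      ext k
      simp only [christoffelVec, PiLp.smul_apply, smul_eq_mul, Finset.mul_sum]
      exact Finset.sum_congr rfl fun i _ ↦ Finset.sum_congr rfl fun j _ ↦ by ring)
    (fun u v v' ↦ by
      ext k
      simp [christoffelVec, mul_add, Finset.sum_add_distrib])
    (fun r u v ↦ by
      ext k
      simp only [christoffelVec, PiLp.smul_apply, smul_eq_mul, Finset.mul_sum]
      exact Finset.sum_congr rfl fun i _ ↦ Finset.sum_congr rfl fun j _ ↦ by ring)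

end Christoffel

/-! ### Second fundamental form, mean curvature and Weingarten operator in coordinates -/

section Hypersurface

variable {k : ℕ} {P : Type*} [TopologicalSpace P] [ChartedSpace (Model k) P]
  [IsManifold (𝓡 k) ∞ P]
  {n : ℕ} {M : Type*} [TopologicalSpace M] [ChartedSpace (Model n) M] [IsManifold (𝓡 n) ∞ M]

/-- The derivative of `f` at `x` in the charts centred at `x` and at `f x`. -/
def coordDeriv (k n : ℕ) {P : Type*} [TopologicalSpace P] [ChartedSpace (Model k) P]
    {M : Type*} [TopologicalSpace M] [ChartedSpace (Model n) M] (f : P → M)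
    (x : P) : Model k →L[ℝ] Model n :=
  fderiv ℝ (coordRep f x) (chartAt (Model k) x x)

/-- The bilinear form `⟨∇_u (df(V)), ν⟩` in the charts centred at `x` and at `f x`, where `V` is the
vector field with constant coordinates `v`. -/
def scalarSecondForm (gM : SmoothMetric n M) (f : P → M) (x : P) (ν : Model n) :
    Model k →ₗ[ℝ] Model k →ₗ[ℝ] ℝ :=
  ((fderiv ℝ (fderiv ℝ (coordRep f x : Model k → Model n))
    (chartAt (Model k) x x)).toLinearMap₁₂ +
    (christoffelBilin gM (f x) (chartAt (Model n) (f x) (f x))).compl₁₂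
      (coordDeriv k n f x).toLinearMap (coordDeriv k n f x).toLinearMap).compr₂
    ((bilin gM (f x)).flip ν)

omit [IsManifold (𝓡 k) ∞ P] in
theorem scalarSecondForm_apply (gM : SmoothMetric n M) {f : P → M}
    (hf : ContMDiff (𝓡 k) (𝓡 n) ∞ f) (x : P) (ν : Model n) (u v : Model k) :
    scalarSecondForm gM f x ν u v =
      bilin gM (f x) (secondDeriv (coordRep f x) (chartAt (Model k) x x) u v +
        christoffelVec gM (f x) (chartAt (Model n) (f x) (f x)) (coordDeriv k n f x u)
          (coordDeriv k n f x v)) ν := by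
  rw [secondDeriv_eq (contDiffAt_coordRep ((hf x).of_le two_le_infty))]
  rfl

variable {gP : SmoothMetric k P} {gM : SmoothMetric n M} {f : P → M}

omit [IsManifold (𝓡 k) ∞ P] [IsManifold (𝓡 n) ∞ M] in
theorem mfderiv_eq_coordDeriv (hf : ContMDiff (𝓡 k) (𝓡 n) ∞ f) (x : P) :
    mfderiv (𝓡 k) (𝓡 n) f x = coordDeriv k n f x :=
  mfderiv_eq_fderiv_coordRep ((hf x).mdifferentiableAt (by simp))

theorem IsIsometricImmersion.bilin_coordDeriv (hf : IsIsometricImmersion gP gM f) (x : P)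
    (u v : Model k) :
    bilin gM (f x) (coordDeriv k n f x u) (coordDeriv k n f x v) = bilin gP x u v := by
  have h := hf.isometric x u v
  rw [mfderiv_eq_coordDeriv hf.smooth] at h
  exact h

theorem IsIsometricImmersion.injective_coordDeriv (hf : IsIsometricImmersion gP gM f) (x : P) :
    Function.Injective (coordDeriv k n f x) := by
  refine (injective_iff_map_eq_zero _).2 fun u hu ↦ ?_
  by_contra h
  have h1 := bilin_pos gP x u h
  rw [← hf.bilin_coordDeriv, hu] at h1
  simp at h1

theorem normalPart_eq (hf : ContMDiff (𝓡 k) (𝓡 n) ∞ f) (x : P) (X : Model n) :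
    normalPart gP gM f x X = X - ∑ i, ∑ j, ((gramAt gP x)⁻¹ i j *
      bilin gM (f x) X (coordDeriv k n f x (stdVec j))) • coordDeriv k n f x (stdVec i) := by
  unfold normalPart
  rw [mfderiv_eq_coordDeriv hf]
  rfl

/-- The subtracted projection is tangent, so pairing with a normal ν does not see it;
`scalarSecondForm` can therefore omit the projection. -/
theorem bilin_normalPart (hf : ContMDiff (𝓡 k) (𝓡 n) ∞ f) (x : P) {ν : Model n}
    (hν : ∀ u, bilin gM (f x) (coordDeriv k n f x u) ν = 0) (X : Model n) :
    bilin gM (f x) (normalPart gP gM f x X) ν = bilin gM (f x) X ν := by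
  rw [normalPart_eq hf]
  simp [map_sub, map_sum, LinearMap.sub_apply, LinearMap.sum_apply, hν]

theorem gramAt_apply (x : P) (i j : Fin k) :
    gramAt gP x i j = bilin gP x (stdVec i) (stdVec j) := rfl

/-- On coordinate vectors, the Gram matrix produced by the pairing cancels the inverse in the
projection. -/
theorem bilin_normalPart_coordDeriv (hf : IsIsometricImmersion gP gM f) (x : P)
    (X : Model n) (w : Model k) :
    bilin gM (f x) (coordDeriv k n f x w) (normalPart gP gM f x X) = 0 := by
  have hG : (gramAt gP x) * (gramAt gP x)⁻¹ = 1 :=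
    Matrix.mul_nonsing_inv _ (det_gramAt_ne_zero gP x).isUnit
  have h (l : Fin k) : bilin gM (f x) (coordDeriv k n f x (stdVec l)) (normalPart gP gM f x X) = 0 := by
    rw [normalPart_eq hf.smooth, map_sub, map_sum]
    simp only [map_sum, map_smul, hf.bilin_coordDeriv, ← gramAt_apply, smul_eq_mul]
    rw [Finset.sum_comm]
    have h1 (j : Fin k) : ∑ i, (gramAt gP x)⁻¹ i j *
        bilin gM (f x) X (coordDeriv k n f x (stdVec j)) * gramAt gP x l i =
        (1 : Matrix (Fin k) (Fin k) ℝ) l j * bilin gM (f x) X (coordDeriv k n f x (stdVec j)) := by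
      rw [← hG, Matrix.mul_apply, Finset.sum_mul]
      exact Finset.sum_congr rfl fun i _ ↦ by ring
    simp only [h1, Matrix.one_apply, ite_mul, one_mul, zero_mul, Finset.sum_ite_eq,
      Finset.mem_univ, if_true]
    rw [bilin_comm, sub_self]
  have h2 : ((bilin gM (f x)).flip (normalPart gP gM f x X)) ∘ₗ
      (coordDeriv k n f x).toLinearMap = 0 := linearMap_ext_stdVec h
  exact congrArg (fun L ↦ L w) h2

theorem secondFundamentalForm_eq (gP : SmoothMetric k P) (gM : SmoothMetric n M)
    (hf : ContMDiff (𝓡 k) (𝓡 n) ∞ f) (x : P) (u v : Model k) :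
    secondFundamentalForm gP gM f x u v = normalPart gP gM f x
      (secondDeriv (coordRep f x) (chartAt (Model k) x x) u v +
        christoffelVec gM (f x) (chartAt (Model n) (f x) (f x)) (coordDeriv k n f x u)
          (coordDeriv k n f x v)) := by
  have h := covDeriv_mfderiv_extend gM hf x u v
  rw [mfderiv_eq_coordDeriv hf] at h
  exact congrArg (normalPart gP gM f x) h

theorem bilin_secondFundamentalForm (gP : SmoothMetric k P) (hf : ContMDiff (𝓡 k) (𝓡 n) ∞ f)
    (x : P) {ν : Model n} (hν : ∀ u, bilin gM (f x) (coordDeriv k n f x u) ν = 0) (u v : Model k) :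
    bilin gM (f x) (secondFundamentalForm gP gM f x u v) ν = scalarSecondForm gM f x ν u v := by
  rw [scalarSecondForm_apply gM hf, secondFundamentalForm_eq gP gM hf]
  exact bilin_normalPart hf x hν _

theorem meanCurvature_eq (hf : ContMDiff (𝓡 k) (𝓡 n) ∞ f) (x : P) {ν : Model n}
    (hν : ∀ u, bilin gM (f x) (coordDeriv k n f x u) ν = 0) {e : Fin k → Model k}
    (he : ∀ i j, bilin gP x (e i) (e j) = if i = j then 1 else 0) :
    meanCurvature gP gM f x ν = (1 / (k : ℝ)) * ∑ a, scalarSecondForm gM f x ν (e a) (e a) := by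
  have h : meanCurvature gP gM f x ν = bilin gM (f x) ((1 / (k : ℝ)) • ∑ i, ∑ j,
      (gramAt gP x)⁻¹ i j • (secondFundamentalForm gP gM f x (stdVec i) (stdVec j) : Model n)) ν :=
    rfl
  have h1 (c : ℝ) (A : Matrix (Fin k) (Fin k) ℝ) (S : Fin k → Fin k → Model n) :
      bilin gM (f x) (c • ∑ i, ∑ j, A i j • S i j) ν =
        c * ∑ i, ∑ j, A i j * bilin gM (f x) (S i j) ν := by
    simp only [map_smul, map_sum, LinearMap.smul_apply, LinearMap.sum_apply, smul_eq_mul]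
  refine (h.trans (h1 _ (gramAt gP x)⁻¹
    fun i j ↦ secondFundamentalForm gP gM f x (stdVec i) (stdVec j))).trans ?_
  rw [← sum_inv_mul_eq_sum_orthonormal (bilin gP x) _ he]
  simp only [bilin_secondFundamentalForm gP hf x hν]
  rfl

/-- Pairing with coordinate vectors multiplies G⁻¹H by G. With the arguments in this order, no
symmetry of the form is needed. -/
theorem bilin_weingarten (hf : ContMDiff (𝓡 k) (𝓡 n) ∞ f) (x : P) {ν : Model n}
    (hν : ∀ u, bilin gM (f x) (coordDeriv k n f x u) ν = 0) (u v : Model k) :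
    bilin gP x v (weingarten gP gM f x ν u) = scalarSecondForm gM f x ν v u := by
  set H : Matrix (Fin k) (Fin k) ℝ := Matrix.of fun i j ↦
    scalarSecondForm gM f x ν (stdVec i) (stdVec j) with hH
  have hw : weingarten gP gM f x ν u =
      ∑ j, ((gramAt gP x)⁻¹ * H).mulVec u j • (stdVec j : Model k) := by
    have h0 : (Matrix.of fun i j ↦ gM.inner (f x)
        (secondFundamentalForm gP gM f x (coordVec x i) (coordVec x j)) ν) = H := by
      ext i j
      exact bilin_secondFundamentalForm gP hf x hν (stdVec i) (stdVec j)
    unfold weingarten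
    rw [h0]
    exact toLin_basisFun_apply _ u
  have hG : (gramAt gP x) * (gramAt gP x)⁻¹ = 1 :=
    Matrix.mul_nonsing_inv _ (det_gramAt_ne_zero gP x).isUnit
  have h1 : (bilin gP x).flip (weingarten gP gM f x ν u) = (scalarSecondForm gM f x ν).flip u := by
    refine linearMap_ext_stdVec fun i ↦ ?_
    have h2 : (gramAt gP x).mulVec (((gramAt gP x)⁻¹ * H).mulVec u) i = H.mulVec u i := by
      rw [Matrix.mulVec_mulVec, ← Matrix.mul_assoc, hG, Matrix.one_mul]
    have h3 : bilin gP x (stdVec i) (weingarten gP gM f x ν u) =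
        (gramAt gP x).mulVec (((gramAt gP x)⁻¹ * H).mulVec u) i := by
      rw [hw, map_sum]
      simp only [map_smul, smul_eq_mul, ← gramAt_apply, Matrix.mulVec, dotProduct]
      exact Finset.sum_congr rfl fun j _ ↦ mul_comm _ _
    refine h3.trans (h2.trans ?_)
    rw [LinearMap.flip_apply, eq_sum_stdVec u]
    simp only [map_sum, map_smul, smul_eq_mul]
    rw [← eq_sum_stdVec u]
    exact (show H.mulVec u i = ∑ j, H i j * u j from rfl).trans
      (Finset.sum_congr rfl fun j _ ↦ mul_comm _ _)
  exact congrArg (fun L ↦ L v) h1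

end Hypersurface

/-! ### Chain rules for coordinate representations -/

section Composition

variable {k : ℕ} {P : Type*} [TopologicalSpace P] [ChartedSpace (Model k) P]
  {l : ℕ} {Q : Type*} [TopologicalSpace Q] [ChartedSpace (Model l) Q]
  {n : ℕ} {M : Type*} [TopologicalSpace M] [ChartedSpace (Model n) M]

/-- The intermediate chart cancels only where f lands in its source, hence the germ. -/
theorem coordRep_comp_eventuallyEq {g : Q → M} {f : P → Q} {x : P}
    (hf : ContMDiffAt (𝓡 k) (𝓡 l) ∞ f x) :
    (coordRep (fun y ↦ g (f y)) x : Model k → Model n) =ᶠ[𝓝 (chartAt (Model k) x x)]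
      fun y ↦ coordRep g (f x) (coordRep f x y : Model l) := by
  have h1 : ContinuousAt (fun y ↦ f ((chartAt (Model k) x).symm y)) (chartAt (Model k) x x) := by
    refine ContinuousAt.comp (g := f) ?_
      ((chartAt (Model k) x).continuousAt_symm (mem_chart_target _ x))
    rw [(chartAt (Model k) x).left_inv (mem_chart_source _ x)]
    exact hf.continuousAt
  have h2 : ∀ᶠ y in 𝓝 (chartAt (Model k) x x),
      f ((chartAt (Model k) x).symm y) ∈ (chartAt (Model l) (f x)).source :=
    h1 ((chartAt (Model l) (f x)).open_source.mem_nhds (by simp))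
  filter_upwards [h2] with y hy
  simp [coordRep, hy]

theorem coordDeriv_comp {g : Q → M} {f : P → Q} {x : P}
    (hg : ContMDiff (𝓡 l) (𝓡 n) ∞ g) (hf : ContMDiff (𝓡 k) (𝓡 l) ∞ f) (u : Model k) :
    coordDeriv k n (fun y ↦ g (f y)) x u = coordDeriv l n g (f x) (coordDeriv k l f x u) := by
  have hF : ContDiffAt ℝ 2 (coordRep f x : _ → Model l) (chartAt (Model k) x x) :=
    contDiffAt_coordRep ((hf x).of_le two_le_infty)
  have hG : ContDiffAt ℝ 2 (coordRep g (f x) : _ → Model n)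
      (coordRep f x (chartAt (Model k) x x) : Model l) := by
    rw [coordRep_center]
    exact contDiffAt_coordRep ((hg _).of_le two_le_infty)
  unfold coordDeriv
  rw [(coordRep_comp_eventuallyEq (hf x)).fderiv_eq]
  have := fderiv_comp (chartAt (Model k) x x) (hG.differentiableAt (by norm_num))
    (hF.differentiableAt (by norm_num))
  rw [coordRep_center] at this
  exact congrArg (fun L ↦ L u) this

theorem secondDeriv_coordRep_comp {g : Q → M} {f : P → Q} {x : P}
    (hg : ContMDiff (𝓡 l) (𝓡 n) ∞ g) (hf : ContMDiff (𝓡 k) (𝓡 l) ∞ f) (u v : Model k) :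
    secondDeriv (coordRep (fun y ↦ g (f y)) x : _ → Model n) (chartAt (Model k) x x) u v =
      secondDeriv (coordRep g (f x)) (chartAt (Model l) (f x) (f x)) (coordDeriv k l f x u)
        (coordDeriv k l f x v) +
      coordDeriv l n g (f x) (secondDeriv (coordRep f x) (chartAt (Model k) x x) u v) := by
  have hF : ContDiffAt ℝ 2 (coordRep f x : _ → Model l) (chartAt (Model k) x x) :=
    contDiffAt_coordRep ((hf x).of_le two_le_infty)
  have hG : ContDiffAt ℝ 2 (coordRep g (f x) : _ → Model n)
      (coordRep f x (chartAt (Model k) x x) : Model l) := by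
    rw [coordRep_center]
    exact contDiffAt_coordRep ((hg _).of_le two_le_infty)
  rw [secondDeriv_congr (coordRep_comp_eventuallyEq (hf x)), secondDeriv_comp hG hF,
    coordRep_center]
  rfl

end Composition

/-! ### Sections of a hypersurface by totally geodesic submanifolds -/

section Section

variable {a b c d : ℕ}
  {N : Type*} [TopologicalSpace N] [ChartedSpace (Model d) N] [IsManifold (𝓡 d) ∞ N]
  {P : Type*} [TopologicalSpace P] [ChartedSpace (Model c) P] [IsManifold (𝓡 c) ∞ P]
  {M : Type*} [TopologicalSpace M] [ChartedSpace (Model b) M] [IsManifold (𝓡 b) ∞ M]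
  {S : Type*} [TopologicalSpace S] [ChartedSpace (Model a) S] [IsManifold (𝓡 a) ∞ S]
  {gN : SmoothMetric d N} {gP : SmoothMetric c P} {gM : SmoothMetric b M} {gS : SmoothMetric a S}
  {f : P → N} {j : M → N} {ι : S → M} {κ : S → P} {o : S}

omit [IsManifold (𝓡 d) ∞ N] [IsManifold (𝓡 c) ∞ P] [IsManifold (𝓡 b) ∞ M] [IsManifold (𝓡 a) ∞ S] in
theorem coordDeriv_comp_eq_of_comm (hf : ContMDiff (𝓡 c) (𝓡 d) ∞ f)
    (hj : ContMDiff (𝓡 b) (𝓡 d) ∞ j) (hι : ContMDiff (𝓡 a) (𝓡 b) ∞ ι)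
    (hκ : ContMDiff (𝓡 a) (𝓡 c) ∞ κ) (hcomm : ∀ x, j (ι x) = f (κ x)) (u : Model a) :
    coordDeriv b d j (ι o) (coordDeriv a b ι o u) =
      coordDeriv c d f (κ o) (coordDeriv a c κ o u) := by
  rw [← coordDeriv_comp hj hι, ← coordDeriv_comp hf hκ, funext hcomm]

omit [IsManifold (𝓡 c) ∞ P] [IsManifold (𝓡 a) ∞ S] in
theorem bilin_coordDeriv_eq_zero_of_comm (hf : ContMDiff (𝓡 c) (𝓡 d) ∞ f)
    (hj : IsIsometricImmersion gM gN j) (hι : ContMDiff (𝓡 a) (𝓡 b) ∞ ι)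
    (hκ : ContMDiff (𝓡 a) (𝓡 c) ∞ κ) (hcomm : ∀ x, j (ι x) = f (κ x)) {n : Model b} {ν : Model d}
    (hn : coordDeriv b d j (ι o) n = ν)
    (hν : ∀ u, bilin gN (f (κ o)) (coordDeriv c d f (κ o) u) ν = 0) (u : Model a) :
    bilin gM (ι o) (coordDeriv a b ι o u) n = 0 := by
  rw [← hj.bilin_coordDeriv, hn, coordDeriv_comp_eq_of_comm hf hj.smooth hι hκ hcomm, hcomm]
  exact hν _

omit [IsManifold (𝓡 c) ∞ P] [IsManifold (𝓡 a) ∞ S] in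
/-- If `M` is totally geodesic, the second fundamental form of `S = M ∩ P` in `M` is the restriction
of that of `P`. -/
theorem scalarSecondForm_eq_of_totallyGeodesicAt (hf : ContMDiff (𝓡 c) (𝓡 d) ∞ f)
    (hj : IsIsometricImmersion gM gN j) (hι : ContMDiff (𝓡 a) (𝓡 b) ∞ ι)
    (hκ : ContMDiff (𝓡 a) (𝓡 c) ∞ κ) (hcomm : ∀ x, j (ι x) = f (κ x))
    (hgeo : TotallyGeodesicAt gM gN j (ι o)) {n : Model b} {ν : Model d}
    (hn : coordDeriv b d j (ι o) n = ν)
    (hν : ∀ u, bilin gN (f (κ o)) (coordDeriv c d f (κ o) u) ν = 0) (u : Model a) :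
    scalarSecondForm gM ι o n u u =
      scalarSecondForm gN f (κ o) ν (coordDeriv a c κ o u) (coordDeriv a c κ o u) := by
  have hΓ (y z : Model d) : christoffelVec gN (j (ι o)) (chartAt (Model d) (j (ι o)) (j (ι o))) y z =
      christoffelVec gN (f (κ o)) (chartAt (Model d) (f (κ o)) (f (κ o))) y z := by rw [hcomm]
  have h1 := hgeo.secondDeriv_add_christoffelVec hj.smooth (coordDeriv a b ι o u)
  -- The common map S → N is differentiated twice through M and through P.
  have h2 : secondDeriv (coordRep (fun y ↦ j (ι y)) o : _ → Model d) (chartAt (Model a) o o) u u =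
      secondDeriv (coordRep (fun y ↦ f (κ y)) o : _ → Model d) (chartAt (Model a) o o) u u := by
    rw [funext hcomm]
  rw [secondDeriv_coordRep_comp hj.smooth hι, secondDeriv_coordRep_comp hf hκ] at h2
  rw [scalarSecondForm_apply gM hι, scalarSecondForm_apply gN hf, ← hj.bilin_coordDeriv, hn,
    map_add]
  have h3 := coordDeriv_comp_eq_of_comm (o := o) hf hj.smooth hι hκ hcomm u
  change _ + christoffelVec gN (j (ι o)) _ (coordDeriv b d j (ι o) (coordDeriv a b ι o u))
    (coordDeriv b d j (ι o) (coordDeriv a b ι o u)) =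
      coordDeriv b d j (ι o) (christoffelVec gM (ι o) _ _ _) at h1
  -- The identity `h1` replaces dj(Γ) by D²j + Γ, so that `h2` applies. The two sides then differ by
  -- df(D²κ(u, u)), which is tangent to the hypersurface and orthogonal to ν.
  rw [← h1, h3, hΓ, ← add_assoc, add_comm (coordDeriv b d j (ι o) _), h2, hcomm]
  simp only [map_add, LinearMap.add_apply, hν, add_zero]

-- A vector dκ(u) satisfies df(dκ u) = tν + df(w) with w in the span of e. Pairing with ν gives t =
-- 0, and injectivity of df gives dκ(u) = w. As dκ has rank a, its range fills the span of the a
-- vectors e.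
omit [IsManifold (𝓡 b) ∞ M] in
theorem exists_coordDeriv_eq {I : Type*} [Fintype I] (hf : IsIsometricImmersion gP gN f)
    (hj : ContMDiff (𝓡 b) (𝓡 d) ∞ j) (hι : ContMDiff (𝓡 a) (𝓡 b) ∞ ι)
    (hκ : IsIsometricImmersion gS gP κ) (hcomm : ∀ x, j (ι x) = f (κ x)) {ν : Model d}
    (hνν : bilin gN (f (κ o)) ν ν = 1)
    (hν : ∀ u, bilin gN (f (κ o)) (coordDeriv c d f (κ o) u) ν = 0) {e : I → Model c}
    (hcard : Fintype.card I = a)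
    (htan : ∀ w, coordDeriv b d j (ι o) w ∈
      Submodule.span ℝ ({ν} ∪ (coordDeriv c d f (κ o)) '' Set.range e)) (i : I) :
    ∃ u, coordDeriv a c κ o u = e i := by
  have hle : LinearMap.range (coordDeriv a c κ o).toLinearMap ≤
      Submodule.span ℝ (Set.range e) := by
    rintro _ ⟨u, rfl⟩
    have h1 := htan (coordDeriv a b ι o u)
    rw [coordDeriv_comp_eq_of_comm hf.smooth hj hι hκ.smooth hcomm, Submodule.span_union,
      Submodule.mem_sup] at h1
    obtain ⟨y, hy, z, hz, hyz⟩ := h1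
    obtain ⟨t, rfl⟩ := Submodule.mem_span_singleton.1 hy
    have h2 : z ∈ (Submodule.span ℝ (Set.range e)).map (coordDeriv c d f (κ o)).toLinearMap := by
      rw [Submodule.map_span]
      exact hz
    obtain ⟨w, hw, rfl⟩ := h2
    have h3 := hν (coordDeriv a c κ o u)
    rw [← hyz] at h3
    simp only [map_add, map_smul, LinearMap.add_apply, LinearMap.smul_apply, smul_eq_mul, hνν,
      ContinuousLinearMap.coe_coe, hν, mul_one, add_zero] at h3
    rw [h3, zero_smul, zero_add] at hyz
    have h4 : w = coordDeriv a c κ o u := hf.injective_coordDeriv _ hyz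
    rw [h4] at hw
    exact hw
  have hrank : Module.finrank ℝ (LinearMap.range (coordDeriv a c κ o).toLinearMap) = a := by
    rw [LinearMap.finrank_range_of_inj (hκ.injective_coordDeriv o)]
    simp
  have heq := Submodule.eq_of_le_of_finrank_le hle (by
    rw [hrank, ← hcard]
    exact finrank_range_le_card e)
  have h5 : e i ∈ LinearMap.range (coordDeriv a c κ o).toLinearMap := by
    rw [heq]
    exact Submodule.subset_span ⟨i, rfl⟩
  exact h5

/-- Since κ is isometric, the preimages of the e i under dκ form an orthonormal basis in which the
trace can be computed. -/
theorem meanCurvature_section (hf : IsIsometricImmersion gP gN f)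
    (hj : IsIsometricImmersion gM gN j) (hι : IsIsometricImmersion gS gM ι)
    (hκ : IsIsometricImmersion gS gP κ) (hcomm : ∀ x, j (ι x) = f (κ x))
    {q : P} (hq : κ o = q)
    (hgeo : TotallyGeodesicAt gM gN j (ι o)) {n : Model b} {ν : Model d}
    (hn : coordDeriv b d j (ι o) n = ν) (hνν : bilin gN (f q) ν ν = 1)
    (hν : ∀ u, bilin gN (f q) (coordDeriv c d f q u) ν = 0) {e : Fin a → Model c}
    (he : ∀ i k, bilin gP q (e i) (e k) = if i = k then 1 else 0)
    (htan : ∀ w, coordDeriv b d j (ι o) w ∈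
      Submodule.span ℝ ({ν} ∪ (coordDeriv c d f q) '' Set.range e)) :
    meanCurvature gS gM ι o n =
      (1 / (a : ℝ)) * ∑ i, scalarSecondForm gN f q ν (e i) (e i) := by
  subst hq
  choose ε hε using exists_coordDeriv_eq hf hj.smooth hι.smooth hκ hcomm hνν hν
    (Fintype.card_fin a) htan
  rw [meanCurvature_eq hι.smooth o
    (bilin_coordDeriv_eq_zero_of_comm hf.smooth hj hι.smooth hκ.smooth hcomm hn hν)
    (e := ε) (fun i k ↦ by rw [← hκ.bilin_coordDeriv, hε, hε, he])]
  simp only [scalarSecondForm_eq_of_totallyGeodesicAt hf.smooth hj hι.smooth hκ.smooth hcomm hgeo hn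
    hν, hε]

end Section

/-! ### From principal curvatures to umbilicity -/

section UmbilicPoints

variable {m : ℕ} {N : Type*} [TopologicalSpace N] [ChartedSpace (Model (m + 1)) N]
    [IsManifold (𝓡 (m + 1)) ∞ N] {gN : SmoothMetric (m + 1) N}
    {P : Type*} [TopologicalSpace P] [ChartedSpace (Model m) P] [IsManifold (𝓡 m) ∞ P]
    {gP : SmoothMetric m P} {f : P → N} {q : P}

/-- A vector normal to a hypersurface is a multiple of the unit normal. -/
theorem eq_smul_of_forall_bilin_coordDeriv (hf : IsIsometricImmersion gP gN f)
    {ν : Model (m + 1)} (hνν : bilin gN (f q) ν ν = 1)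
    (hν : ∀ u, bilin gN (f q) (coordDeriv m (m + 1) f q u) ν = 0)
    {e : Fin m → Model m} (he : ∀ i k, bilin gP q (e i) (e k) = if i = k then 1 else 0)
    {X : Model (m + 1)} (hX : ∀ u, bilin gN (f q) (coordDeriv m (m + 1) f q u) X = 0) :
    X = bilin gN (f q) X ν • ν := by
  -- ν together with the df(e i) is an orthonormal system of m + 1 vectors, hence spans; X - ⟨X, ν⟩ν
  -- is orthogonal to all of it.
  let b : Option (Fin m) → Model (m + 1) :=
    fun i ↦ i.elim ν fun i ↦ coordDeriv m (m + 1) f q (e i)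
  have hb : ∀ i k, bilin gN (f q) (b i) (b k) = if i = k then 1 else 0 := by
    rintro (_ | i) (_ | k)
    · simpa [b] using hνν
    · simpa [b] using (bilin_comm gN (f q) ν _).trans (hν (e k))
    · simpa [b] using hν (e i)
    · simp [b, hf.bilin_coordDeriv, he]
  refine sub_eq_zero.1 (eq_zero_of_forall_bilin_eq_zero (bilin gN (f q)) (bilin_pos gN _)
    (span_eq_top_of_orthonormal _ hb (by simp)) ?_)
  rintro (_ | i)
  · simp [b, hνν]
  · have h1 := (bilin_comm gN (f q) X _).trans (hX (e i))
    have h2 := (bilin_comm gN (f q) ν _).trans (hν (e i))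
    simp [b, h1, h2]

theorem isUmbilicAt_of_scalarSecondForm_eq (hf : IsIsometricImmersion gP gN f) (hm : m ≠ 0)
    {ν : Model (m + 1)} (hνν : bilin gN (f q) ν ν = 1)
    (hν : ∀ u, bilin gN (f q) (coordDeriv m (m + 1) f q u) ν = 0)
    {e : Fin m → Model m} (he : ∀ i k, bilin gP q (e i) (e k) = if i = k then 1 else 0) {t : ℝ}
    (ht : ∀ i k, scalarSecondForm gN f q ν (e i) (e k) = if i = k then t else 0) :
    IsUmbilicAt gP gN f q ∧ meanCurvature gP gN f q ν = t := by
  have hspan := span_eq_top_of_orthonormal (bilin gP q) he (by simp)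
  have hform : scalarSecondForm gN f q ν = t • bilin gP q :=
    bilin_ext hspan fun i k ↦ by simp [ht, he]
  have hII (u v : Model m) :
      secondFundamentalForm gP gN f q u v = (t * bilin gP q u v) • ν := by
    rw [eq_smul_of_forall_bilin_coordDeriv hf hνν hν he
      (X := secondFundamentalForm gP gN f q u v) ?_]
    · rw [bilin_secondFundamentalForm gP hf.smooth q hν, hform]
      rfl
    · intro w
      rw [secondFundamentalForm_eq gP gN hf.smooth]
      exact bilin_normalPart_coordDeriv hf q _ w
  have hmean : meanCurvature gP gN f q ν = t := by
    rw [meanCurvature_eq hf.smooth q hν he]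
    simp [ht]
    field_simp
  have hH : (meanCurvatureVector gP gN f q : Model (m + 1)) = t • ν := by
    rw [eq_smul_of_forall_bilin_coordDeriv hf hνν hν he
      (X := meanCurvatureVector gP gN f q) ?_]
    · exact congrArg (· • ν) hmean
    · intro w
      have h1 (c : ℝ) (A : Matrix (Fin m) (Fin m) ℝ) (B : Fin m → Fin m → Model (m + 1))
          (hB : ∀ i k, bilin gN (f q) (coordDeriv m (m + 1) f q w) (B i k) = 0) :
          bilin gN (f q) (coordDeriv m (m + 1) f q w) (c • ∑ i, ∑ k, A i k • B i k) = 0 := by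
        simp [map_sum, hB]
      refine h1 _ (gramAt gP q)⁻¹
        (fun i k ↦ secondFundamentalForm gP gN f q (stdVec i) (stdVec k)) fun i k ↦ ?_
      rw [hII, map_smul, hν, smul_zero]
  refine ⟨fun u v ↦ ?_, hmean⟩
  refine (hII u v).trans ?_
  refine Eq.trans ?_ (congrArg (fun X : Model (m + 1) ↦ bilin gP q u v • X) hH.symm)
  rw [smul_smul, mul_comm]

/-- Choose γ with s - 1 elements avoiding i and k, which s < |I| allows, and compare γ ∪ {i} with γ
∪ {k}. -/
theorem eq_of_forall_sum_eq {I : Type*} [Fintype I] [DecidableEq I] {t : I → ℝ} {s : ℕ}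
    (hs : 0 < s) (hsI : s < Fintype.card I)
    (h : ∀ α β : Finset I, α.card = s → β.card = s → ∑ i ∈ α, t i = ∑ i ∈ β, t i) (i k : I) :
    t i = t k := by
  by_cases hik : i = k
  · rw [hik]
  have hcard : s - 1 ≤ (Finset.univ \ {i, k} : Finset I).card := by
    rw [Finset.card_sdiff_of_subset (Finset.subset_univ _), Finset.card_pair hik,
      Finset.card_univ]
    omega
  obtain ⟨γ, hγ, hγs⟩ := Finset.exists_subset_card_eq hcard
  have hi : i ∉ γ := fun hi ↦ by simpa using hγ hi
  have hk : k ∉ γ := fun hk ↦ by simpa using hγ hk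
  have := h (insert i γ) (insert k γ) (by rw [Finset.card_insert_of_notMem hi]; omega)
    (by rw [Finset.card_insert_of_notMem hk]; omega)
  rw [Finset.sum_insert hi, Finset.sum_insert hk] at this
  linarith

end UmbilicPoints

end Umbilic

end

/-! ### The umbilicity theorem -/

theorem corollary4p3 {m s : ℕ} (hm : 3 ≤ m + 1) (hs : 0 < s) (hsm : s ≤ m - 1)
    -- the ambient Riemannian manifold, of dimension `m + 1`
    {N : Type*} [TopologicalSpace N] [ChartedSpace (Model (m + 1)) N]
    [IsManifold (𝓡 (m + 1)) ∞ N] (gN : SmoothMetric (m + 1) N)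
    -- the hypersurface, a point of it, and the unit normal there
    {P : Type*} [TopologicalSpace P] [ChartedSpace (Model m) P] [IsManifold (𝓡 m) ∞ P]
    (gP : SmoothMetric m P) (f : P → N) (hf : IsIsometricImmersion gP gN f)
    (q : P) (ν : TangentSpace (𝓡 (m + 1)) (f q)) (hν : IsUnitNormal gP gN f q ν)
    -- an orthonormal basis of eigenvectors of the Weingarten operator
    (e : Fin m → TangentSpace (𝓡 m) q)
    (he : ∀ i j, gP.inner q (e i) (e j) = if i = j then 1 else 0)
    (heig : ∀ i, ∃ μ : ℝ, Module.End.HasEigenvector (weingarten gP gN f q ν) μ (e i))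
    -- the submanifolds `M α` of dimension `s + 1`, one for each `s`-element set `α` of eigenvectors
    (M : {α : Finset (Fin m) // α.card = s} → Type*)
    [∀ α, TopologicalSpace (M α)] [∀ α, ChartedSpace (Model (s + 1)) (M α)]
    [∀ α, IsManifold (𝓡 (s + 1)) ∞ (M α)] (gM : ∀ α, SmoothMetric (s + 1) (M α))
    (j : ∀ α, M α → N) (hj : ∀ α, IsIsometricImmersion (gM α) gN (j α))
    -- the submanifolds `S α = M α ∩ P` of dimension `s`, and the point `q` as a point of `S α`
    (S : {α : Finset (Fin m) // α.card = s} → Type*)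
    [∀ α, TopologicalSpace (S α)] [∀ α, ChartedSpace (Model s) (S α)]
    [∀ α, IsManifold (𝓡 s) ∞ (S α)] (gS : ∀ α, SmoothMetric s (S α))
    (ι : ∀ α, S α → M α) (hι : ∀ α, IsIsometricImmersion (gS α) (gM α) (ι α))
    (κ : ∀ α, S α → P) (hκ : ∀ α, IsIsometricImmersion (gS α) gP (κ α))
    (o : ∀ α, S α) (ho : ∀ α, κ α (o α) = q)
    (hS : ∀ α, IsIntersectionAt (j α) f (ι α) (κ α) (o α))
    -- `M α` is totally geodesic at `q`, and its tangent space there is spanned by `ν` and the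
    -- eigenvectors in `α`
    (hgeo : ∀ α, TotallyGeodesicAt (gM α) gN (j α) (ι α (o α)))
    (htan : ∀ α, Set.range (fun w : TangentSpace (𝓡 (s + 1)) (ι α (o α)) ↦
        tangentMap (𝓡 (s + 1)) (𝓡 (m + 1)) (j α) ⟨ι α (o α), w⟩) =
      (fun X : TangentSpace (𝓡 (m + 1)) (f q) ↦
          (⟨f q, X⟩ : TangentBundle (𝓡 (m + 1)) N)) ''
        (Submodule.span ℝ ({ν} ∪ (fun i ↦ mfderiv (𝓡 m) (𝓡 (m + 1)) f q (e i)) ''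
          (α.1 : Set (Fin m))) : Set (TangentSpace (𝓡 (m + 1)) (f q))))
    -- `ν` as a tangent vector of `M α`, which is normal to `S α`
    (n : ∀ α, TangentSpace (𝓡 (s + 1)) (ι α (o α)))
    (hn : ∀ α, tangentMap (𝓡 (s + 1)) (𝓡 (m + 1)) (j α) ⟨ι α (o α), n α⟩ = ⟨f q, ν⟩)
    -- the mean curvature of `S α` in `M α` at `q` does not depend on `α`
    (hmean : ∀ α β, meanCurvature (gS α) (gM α) (ι α) (o α) (n α) =
      meanCurvature (gS β) (gM β) (ι β) (o β) (n β)) :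
    IsUmbilicAt gP gN f q ∧
      ∀ α, meanCurvature gP gN f q ν = meanCurvature (gS α) (gM α) (ι α) (o α) (n α) := by
  -- The base points j(ι(o)) and f(q) are equal but not by definition, so tangent vectors are
  -- compared in the tangent bundle; this passes to their coordinates.
  have hmodel {a b : N} (hab : a = b) {X : TangentSpace (𝓡 (m + 1)) a}
      {Y : TangentSpace (𝓡 (m + 1)) b}
      (h : (⟨a, X⟩ : TangentBundle (𝓡 (m + 1)) N) = ⟨b, Y⟩) :
      (X : Model (m + 1)) = (Y : Model (m + 1)) := by
    subst hab
    exact Bundle.TotalSpace.mk_inj.1 h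
  have hνν : bilin gN (f q) ν ν = 1 := hν.1
  have hνn (u : Model m) : bilin gN (f q) (coordDeriv m (m + 1) f q u) ν = 0 := by
    have h := hν.2 u
    rw [mfderiv_eq_coordDeriv hf.smooth] at h
    exact h
  have he' (i k : Fin m) : bilin gP q (e i) (e k) = if i = k then 1 else 0 := he i k
  choose μ hμ using heig
  have hform (i k : Fin m) :
      scalarSecondForm gN f q ν (e i) (e k) = if i = k then μ k else 0 := by
    have h1 : weingarten gP gN f q ν (e k) = μ k • e k := (hμ k).apply_eq_smul
    refine (bilin_weingarten (gP := gP) hf.smooth q hνn (e k) (e i)).symm.trans ?_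
    refine (congrArg (bilin gP q (e i)) h1).trans ?_
    refine ((bilin gP q (e i)).map_smul (μ k) (e k)).trans ?_
    rw [he']
    simp
  have hsec (α : {α : Finset (Fin m) // α.card = s}) :
      meanCurvature (gS α) (gM α) (ι α) (o α) (n α) = (1 / (s : ℝ)) * ∑ i ∈ α.1, μ i := by
    have hjf : j α (ι α (o α)) = f q := by rw [(hS α).comm, ho]
    have hn' : coordDeriv (s + 1) (m + 1) (j α) (ι α (o α)) (n α) = ν := by
      have h := hmodel hjf (hn α)
      rw [mfderiv_eq_coordDeriv (hj α).smooth] at h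
      exact h
    -- An enumeration of α turns it into a family indexed by `Fin s`, the dimension of S_α.
    let φ : Fin s ≃ α.1 := (α.1.equivFinOfCardEq α.2).symm
    let e' : Fin s → Model m := fun i ↦ e (φ i)
    have hset : (coordDeriv m (m + 1) f q) '' Set.range e' =
        (fun i ↦ coordDeriv m (m + 1) f q (e i)) '' (α.1 : Set (Fin m)) := by
      ext Y
      constructor
      · rintro ⟨_, ⟨i, rfl⟩, rfl⟩
        exact ⟨φ i, (φ i).2, rfl⟩
      · rintro ⟨i, hi, rfl⟩
        exact ⟨_, ⟨φ.symm ⟨i, hi⟩, rfl⟩, congrArg (fun k : α.1 ↦ coordDeriv m (m + 1) f q (e k))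
          (φ.apply_symm_apply ⟨i, hi⟩)⟩
    have htan' (w : Model (s + 1)) : coordDeriv (s + 1) (m + 1) (j α) (ι α (o α)) w ∈
        Submodule.span ℝ ({(ν : Model (m + 1))} ∪
          (coordDeriv m (m + 1) f q) '' Set.range e') := by
      have hmem := (htan α).subset ⟨w, rfl⟩
      obtain ⟨X, hX, hXw⟩ := hmem
      have h1 := hmodel hjf.symm hXw
      rw [mfderiv_eq_coordDeriv (hj α).smooth] at h1
      rw [mfderiv_eq_coordDeriv hf.smooth] at hX
      refine Eq.subst (motive := fun Y : Model (m + 1) ↦ Y ∈ Submodule.span ℝ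
        ({(ν : Model (m + 1))} ∪ (coordDeriv m (m + 1) f q) '' Set.range e')) h1 ?_
      refine Eq.subst (motive := fun T : Set (Model (m + 1)) ↦ X ∈ Submodule.span ℝ
        ({(ν : Model (m + 1))} ∪ T)) hset.symm ?_
      exact hX
    rw [meanCurvature_section hf (hj α) (hι α) (hκ α) (hS α).comm (ho α) (hgeo α) hn' hνν hνn
      (e := e') (fun i k ↦ by simp [e', he', Subtype.ext_iff.symm]) htan']
    congr 1
    simp only [e', hform, if_true]
    exact (φ.sum_comp fun i ↦ μ i).trans (Finset.sum_coe_sort α.1 μ)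
  have hs' : (s : ℝ) ≠ 0 := by exact_mod_cast hs.ne'
  have hμeq : ∀ i k, μ i = μ k := by
    -- The subtraction in s ≤ m - 1 is truncated, but 0 < s still yields s < m.
    refine eq_of_forall_sum_eq hs (by rw [Fintype.card_fin]; omega) fun α β hα hβ ↦ ?_
    have h := hmean ⟨α, hα⟩ ⟨β, hβ⟩
    rw [hsec, hsec] at h
    exact mul_left_cancel₀ (one_div_ne_zero hs') h
  let i₀ : Fin m := ⟨0, by omega⟩
  obtain ⟨h1, h2⟩ := isUmbilicAt_of_scalarSecondForm_eq (gP := gP) (t := μ i₀) hf (by omega) hνν hνn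
    he' (fun i k ↦ by rw [hform, hμeq k i₀])
  refine ⟨h1, fun α ↦ h2.trans ?_⟩
  rw [hsec, Finset.sum_congr rfl fun i _ ↦ hμeq i i₀, Finset.sum_const, α.2, nsmul_eq_mul]
  field_simp
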